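/- Conventions. $\Sigma=\{0,1\}$; $X\restriction n$ is the string of the first $n$ bits of $X\in\Sigma^\infty$; $\lambda$ is the empty string; "polynomial time" refers to (multi-tape, equivalently multi-stack) Turing machines. Fix a universal Turing machine $\mathcal U$, i.e. for every Turing machine $M$ there are a string $\pi$ and a polynomial $P$ such that, whenever $M$ on input $x$ outputs $y$ within $t$ steps, $\mathcal U$ on input $\pi x$ outputs $y$ within $P(|x|+t)$ steps. For $t:\mathbb N\to\mathbb N$ let $K_t(x)$ be the length of a shortest $p\in\Sigma^*$ such that $\mathcal U(p)=x$ within $t(|x|)$ steps ($\infty$ if there is none), and let $$\mathcal K^{\mathrm{str}}_{\mathrm{poly}}(X)=\inf_{c\in\mathbb N}\ \limsup_{n\to\infty}\frac{K_{n^c}(X\restriction n)}{n}.$$ For real $s$, an $s$-supergale is a function $d:\Sigma^*\to[0,\infty)\cap\mathbb Q$ with $d(\lambda)=1$ and $d(w)\ge 2^{-s}(d(w0)+d(w1))$ for all $w$; it is an $s$-gale if equality always holds. Its success set is $S^\infty(d)=\{X:\limsup_n d(X\restriction n)=\infty\}$. Let $\mathrm{cdim}_{\mathrm P}(X)$ be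 the infimum of all $s\ge 0$ for which some $s$-gale $d$ with $X\in S^\infty(d)$ is exactly computable in polynomial time. For a Borel probability measure $\nu$ on $\Sigma^\infty$ and $w\in\Sigma^n$ let $\nu_n(w)=\nu\{X: X\restriction n=w\}$. The measure $\nu$ is polynomial-time samplable with seed length $q:\mathbb N\to\mathbb N$ ($q$ polynomially bounded) if there is a machine $M$ which on every input $(1^n,r)$ with $|r|=q(n)$ halts in time polynomial in $n$ and satisfies $\Pr_{r\in\Sigma^{q(n)}}[M(1^n,r)=w]=\nu_n(w)$ for all $n$ and all $w\in\Sigma^n$. A supergale $d$ is polynomial-time $\nu$-approximable if there is a polynomial $T$ such that for every $k\in\mathbb N$ there are a constant $c\in(0,1)$ and a probabilistic machine $M$, running in time $T(n)$ on inputs of length $n$ and using a number of random bits that is a polynomial in $n$, such that for every $n$: for each $w\in\Sigma^n$ with $\nu_n(w)=0$, $M(w)\in[c\,d(w),d(w)]$ for all outcomes of the coin tosses of $M$; and $\Pr[M(w)\notin[c\,d(w),d(w)]]\le n^{-k}$, where the probability is over $w\sim\nu_n$ and the coin tosses of $M$ (for $n=0$ and $k\geq 1$ the last condition is void). Statement.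 Let $s<1/2$ and let $\nu$ be a probability measure on $\Sigma^\infty$ that is polynomial-time samplable with a seed length $q$ satisfying $q(n)\le sn$ for all $n$. Suppose that for every $s'\in(s,1/2)$ and every polynomial-time $\nu$-approximable $s'$-supergale $d$ one has $\nu(S^\infty(d))=0$. Then for $\nu$-almost every $X\in\Sigma^\infty$, $$\mathcal K^{\mathrm{str}}_{\mathrm{poly}}(X)\le s\qquad\text{and}\qquad \mathrm{cdim}_{\mathrm P}(X)\ge \tfrac12 .$$ -/

import Mathlib

open MeasureTheory Filter
open scoped ENNReal NNReal

noncomputable section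

namespace PolyDim

/-! ### Machines with a step count

Machines are Mathlib's multi-stack Turing machines `Turing.FinTM2`, bundled in
`Turing.TM2ComputableAux Γ₀ Γ₁` with an input alphabet `Γ₀` and an output alphabet `Γ₁`. -/

/-- `M` halts on input `x` with output `y` after at most `t` steps. -/
def RunsIn {Γ₀ Γ₁ : Type} (M : Turing.TM2ComputableAux Γ₀ Γ₁) (x : List Γ₀) (y : List Γ₁)
    (t : ℕ) : Prop :=
  Nonempty (Turing.TM2OutputsInTime M.tm (x.map M.inputAlphabet.invFun)
    (some (y.map M.outputAlphabet.invFun)) t)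

/-- A probabilistic machine reads its ordinary input `w`, followed by the outcomes `r` of its
coin tosses; the two parts are told apart by tags. -/
abbrev ProbMachine : Type 1 := Turing.TM2ComputableAux (Bool ⊕ Bool) Bool

/-- The input word that consists of the string `w` and the random bits `r`. -/
def withCoins (w r : List Bool) : List (Bool ⊕ Bool) :=
  w.map Sum.inl ++ r.map Sum.inr

/-- The probability that a uniformly random string `r` of `m` bits satisfies `P`. -/
def coinProb (m : ℕ) (P : List Bool → Prop) : ℝ≥0∞ :=
  (Nat.card {r : Fin m → Bool // P (List.ofFn r)} : ℝ≥0∞) / 2 ^ m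

/-- The code of a nonnegative rational number: numerator and denominator of the reduced fraction
in binary, where each bit of the numerator is preceded by `true` and the end of the numerator is
marked by `false`. -/
def encodeRat (v : ℚ≥0) : List Bool :=
  ((Computability.encodeNat v.num).flatMap fun b => [true, b]) ++
    false :: Computability.encodeNat v.den

/-! ### Time-bounded Kolmogorov complexity -/

/-- `U` is a universal machine: for each machine `M` there is a finite program `π` such that `U` on
`π` followed by `x` simulates `M` on `x`, with at most polynomial slowdown. -/
def IsUniversal (U : Turing.TM2ComputableAux Bool Bool) : Prop :=
  ∀ M : Turing.TM2ComputableAux Bool Bool, ∃ (π : List Bool) (P : Polynomial ℕ),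
    ∀ (x y : List Bool) (t : ℕ), RunsIn M x y t → RunsIn U (π ++ x) y (P.eval (x.length + t))

/-- The `t`-time bounded plain Kolmogorov complexity `K_t(x)` with respect to `U`
(`⊤` if no program prints `x` within `t(|x|)` steps). -/
def timeBoundedK (U : Turing.TM2ComputableAux Bool Bool) (t : ℕ → ℕ) (x : List Bool) : ℕ∞ :=
  ⨅ (p : List Bool) (_ : RunsIn U p x (t x.length)), (p.length : ℕ∞)

/-- The first `n` bits of the infinite binary sequence `X`. -/
def pre (X : ℕ → Bool) (n : ℕ) : List Bool :=
  List.ofFn fun i : Fin n => X i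

/-- The upper polynomial-time Kolmogorov complexity rate of `X`: the infimum over the time bounds
`t(n) = n ^ c` of `limsup K_t(X ↾ n) / n`. -/
def KstrPoly (U : Turing.TM2ComputableAux Bool Bool) (X : ℕ → Bool) : ℝ≥0∞ :=
  ⨅ c : ℕ, limsup
    (fun n : ℕ => ((timeBoundedK U (fun m => m ^ c) (pre X n) : ℕ∞) : ℝ≥0∞) / (n : ℝ≥0∞)) atTop

/-! ### Gales and polynomial-time dimension -/

/-- `s`-supergales with rational values and initial capital `1`. -/
def IsSupergale (s : ℝ) (d : List Bool → ℚ≥0) : Prop :=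
  d [] = 1 ∧ ∀ w, ((d (w ++ [false]) : ℝ) + (d (w ++ [true]) : ℝ)) / (2 : ℝ) ^ s ≤ (d w : ℝ)

/-- `s`-gales with rational values and initial capital `1`. -/
def IsGale (s : ℝ) (d : List Bool → ℚ≥0) : Prop :=
  d [] = 1 ∧ ∀ w, (d w : ℝ) = ((d (w ++ [false]) : ℝ) + (d (w ++ [true]) : ℝ)) / (2 : ℝ) ^ s

/-- The success set of `d`: the sequences `X` with `limsup d(X ↾ n) = ∞`. -/
def successSet (d : List Bool → ℚ≥0) : Set (ℕ → Bool) :=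
  {X | limsup (fun n : ℕ => (((d (pre X n) : ℝ≥0)) : ℝ≥0∞)) atTop = ⊤}

/-- `d` is exactly computable in polynomial time. -/
def ExactPolyTime (d : List Bool → ℚ≥0) : Prop :=
  Nonempty (Turing.TM2ComputableInPolyTime (id : List Bool → List Bool) encodeRat d)

/-- The polynomial-time dimension of a sequence (`⊤` would be the infimum of the empty set). -/
def cdimP (X : ℕ → Bool) : ℝ≥0∞ :=
  ⨅ (s : ℝ≥0) (_ : ∃ d : List Bool → ℚ≥0, IsGale s d ∧ ExactPolyTime d ∧ X ∈ successSet d),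
    (s : ℝ≥0∞)

/-! ### Distributions on infinite sequences -/

/-- The cylinder of a finite string `w`: the infinite sequences that begin with `w`. -/
def cylinder (w : List Bool) : Set (ℕ → Bool) :=
  {X | pre X w.length = w}

/-- The probabilistic machine `M`, using `q n` random bits on input `1ⁿ`, samples `ν` in
polynomial time: for each `n`, the output `M(1ⁿ, r)` for uniformly random `r` of length `q n` is
distributed as the first `n` bits of a `ν`-random sequence. -/
def IsPolyTimeSampler (ν : Measure (ℕ → Bool)) (M : ProbMachine) (q : ℕ → ℕ) : Prop :=
  ∃ T : Polynomial ℕ,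
    (∀ n, q n ≤ T.eval n) ∧
    (∀ (n : ℕ) (r : List Bool), r.length = q n →
      ∃ y, RunsIn M (withCoins (List.replicate n true) r) y (T.eval n)) ∧
    ∀ (n : ℕ) (w : List Bool), w.length = n →
      coinProb (q n)
        (fun r => RunsIn M (withCoins (List.replicate n true) r) w (T.eval n)) = ν (cylinder w)

/-- On input `w` and random bits `r`, the machine `M` outputs within `t` steps a rational number
in the interval `[c * d w, d w]`. -/
def ApproximatesAt (M : ProbMachine) (d : List Bool → ℚ≥0) (c : ℝ) (w r : List Bool)
    (t : ℕ) : Prop :=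
  ∃ v : ℚ≥0, RunsIn M (withCoins w r) (encodeRat v) t ∧ c * (d w : ℝ) ≤ (v : ℝ) ∧
    (v : ℝ) ≤ (d w : ℝ)

/-- `d` is polynomial-time `ν`-approximable. There is a polynomial time bound `T` such that for each
`k` there are a constant `c` with `0 < c < 1` and a probabilistic `T(n)`-time machine `M`, using a
polynomial number `ρ(n)` of random bits, whose output lies in `[c * d w, d w]`

* for all outcomes of its coin tosses, if `w` is not in the support of `ν_n`;
* except with probability at most `n ^ (-k)`, if `w` is drawn from `ν_n`. -/
def IsPolyTimeApproximable (ν : Measure (ℕ → Bool)) (d : List Bool → ℚ≥0) : Prop :=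
  ∃ T : Polynomial ℕ, ∀ k : ℕ, ∃ (M : ProbMachine) (ρ : Polynomial ℕ) (c : ℝ),
    0 < c ∧ c < 1 ∧
    (∀ w r : List Bool, r.length = ρ.eval w.length →
      ∃ y, RunsIn M (withCoins w r) y (T.eval w.length)) ∧
    (∀ w r : List Bool, r.length = ρ.eval w.length →
      ¬ ApproximatesAt M d c w r (T.eval w.length) → 0 < ν (cylinder w)) ∧
    ∀ n : ℕ,
      ∑ w : Fin n → Bool, ν (cylinder (List.ofFn w)) *
        coinProb (ρ.eval n) (fun r => ¬ ApproximatesAt M d c (List.ofFn w) r (T.eval n))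
        ≤ ((n : ℝ≥0∞) ^ k)⁻¹

end PolyDim

end

/-! The two bounds are independent and each holds almost surely. Complexity: almost every `X` has
only prefixes of positive measure, so each `X ↾ n` is the sampler's output on some seed of length `q
n ≤ s * n`. A program for it consists of a constant part, the seed, and a code for `n`. Coding `n`
as quotient and remainder modulo `m`, both in unary, costs about `n / m` bits, and `m → ∞` gives the
rate `s` (`KstrPoly_le_of_sampled`). Dimension: an exactly computable gale is approximable without
coins or error, so if its exponent is below `1/2` it succeeds only on a null set. There are
countably many such gales, one program of `U` determining each (`countable_exactPolyTime`), so the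
union of their success sets is null. Both halves must reformat the input of a given machine. A
finite-state transducer does this, at linear cost (`RunsIn.transducerAux`). -/

/-! ### Counting steps of a transition function -/

/-- `f` leads from `a` to `b` in exactly `n` steps. -/
def StepsTo {α : Type*} (f : α → Option α) (n : ℕ) (a b : α) : Prop :=
  (flip Bind.bind f)^[n] (some a) = some b

theorem StepsTo.refl {α : Type*} (f : α → Option α) (a : α) : StepsTo f 0 a a := rfl

theorem StepsTo.single {α : Type*} {f : α → Option α} {a b : α} (h : f a = some b) :
    StepsTo f 1 a b := h

theorem StepsTo.trans {α : Type*} {f : α → Option α} {m n : ℕ} {a b c : α}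
    (h₁ : StepsTo f m a b) (h₂ : StepsTo f n b c) : StepsTo f (m + n) a c := by
  unfold StepsTo at *
  rw [add_comm, Function.iterate_add_apply, h₁, h₂]

theorem StepsTo.head {α : Type*} {f : α → Option α} {n : ℕ} {a b c : α}
    (h₁ : f a = some b) (h₂ : StepsTo f n b c) : StepsTo f (n + 1) a c :=
  add_comm 1 n ▸ (StepsTo.single h₁).trans h₂

theorem iterate_bind_none {α : Type*} (f : α → Option α) (n : ℕ) :
    (flip Bind.bind f)^[n] (none : Option α) = none :=
  Function.iterate_fixed rfl n

/-- Runs are deterministic and `none` is absorbing, so no run outlasts one that has reached a halted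
configuration. -/
theorem stepsTo_halt_le {α : Type*} {f : α → Option α} {m n : ℕ} {a b c : α}
    (h₁ : StepsTo f m a b) (hb : f b = none) (h₂ : StepsTo f n a c) : n ≤ m := by
  by_contra! h
  obtain ⟨k, rfl⟩ := Nat.exists_eq_add_of_lt h
  unfold StepsTo at *
  rw [show m + k + 1 = k + 1 + m by ring, Function.iterate_add_apply, h₁,
    Function.iterate_succ_apply] at h₂
  change (flip Bind.bind f)^[k] (f b) = _ at h₂
  rw [hb, iterate_bind_none] at h₂
  cases h₂

theorem stepsTo_halt_unique {α : Type*} {f : α → Option α} {m n : ℕ} {a b c : α}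
    (h₁ : StepsTo f m a b) (hb : f b = none) (h₂ : StepsTo f n a c) (hc : f c = none) :
    b = c := by
  obtain rfl := le_antisymm (stepsTo_halt_le h₂ hc h₁) (stepsTo_halt_le h₁ hb h₂)
  exact Option.some_injective _ (h₁.symm.trans h₂)

/-- Simulation principle: only successful steps have to be matched, and the step count is preserved.
-/
theorem StepsTo.map {α β : Type*} {f : α → Option α} {g : β → Option β} (φ : α → β)
    (hφ : ∀ a b, f a = some b → g (φ a) = some (φ b)) :
    ∀ {n : ℕ} {a b : α}, StepsTo f n a b → StepsTo g n (φ a) (φ b) := by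
  intro n
  induction n with
  | zero => intro a b h; cases h; exact StepsTo.refl _ _
  | succ n ih =>
    intro a b h
    unfold StepsTo at h
    rw [Function.iterate_succ_apply] at h
    change (flip Bind.bind f)^[n] (f a) = some b at h
    cases hc : f a with
    | none => rw [hc, iterate_bind_none] at h; cases h
    | some c =>
      rw [hc] at h
      exact (ih h).head (hφ _ _ hc)

/-! ### Embedding a machine into one with additional stacks -/

namespace Turing

theorem initList_eq (tm : FinTM2) (s : List (tm.Γ tm.k₀)) :
    initList tm s = ⟨some tm.main, tm.initialState, Function.update (fun _ => []) tm.k₀ s⟩ := by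
  unfold initList
  congr 1
  funext k
  by_cases h : k = tm.k₀
  · subst h; simp
  · simp [h]

theorem haltList_eq (tm : FinTM2) (s : List (tm.Γ tm.k₁)) :
    haltList tm s = ⟨none, tm.initialState, Function.update (fun _ => []) tm.k₁ s⟩ := by
  unfold haltList
  congr 1
  funext k
  by_cases h : k = tm.k₁
  · subst h; simp
  · simp [h]

theorem haltList_injective (tm : FinTM2) : Function.Injective (haltList tm) := by
  intro s s' h
  rw [haltList_eq, haltList_eq] at h
  have := congr_fun (TM2.Cfg.mk.inj h).2.2 tm.k₁
  simpa using this

namespace TM2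

variable {K K' : Type} {Γ : K → Type} {Γ' : K' → Type} {Λ Λ' σ σ' : Type}

/-- The alphabets of a machine with additional stacks. -/
abbrev sumAlphabet (Γ : K → Type) (Γ' : K' → Type) : K ⊕ K' → Type
  | Sum.inl k => Γ k
  | Sum.inr k => Γ' k

/-- The stacks of a machine together with additional stacks. -/
def sumStacks (S : ∀ k, List (Γ k)) (E : ∀ k, List (Γ' k)) :
    ∀ k : K ⊕ K', List (sumAlphabet Γ Γ' k)
  | Sum.inl k => S k
  | Sum.inr k => E k

theorem update_sumStacks_inl [DecidableEq K] [DecidableEq K'] (S : ∀ k, List (Γ k))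
    (E : ∀ k, List (Γ' k)) (k : K) (x : List (Γ k)) :
    Function.update (sumStacks S E) (Sum.inl k) x = sumStacks (Function.update S k x) E := by
  funext j
  rcases j with j | j
  · by_cases h : j = k
    · subst h
      exact (Function.update_self ..).trans (Function.update_self (β := fun k => List (Γ k)) ..).symm
    · exact (Function.update_of_ne (by simpa using h) ..).trans
        (Function.update_of_ne (β := fun k => List (Γ k)) h ..).symm
  · exact Function.update_of_ne (by simp) ..

theorem update_sumStacks_inr [DecidableEq K] [DecidableEq K'] (S : ∀ k, List (Γ k))
    (E : ∀ k, List (Γ' k)) (k : K') (x : List (Γ' k)) :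
    Function.update (sumStacks S E) (Sum.inr k) x = sumStacks S (Function.update E k x) := by
  funext j
  rcases j with j | j
  · exact Function.update_of_ne (by simp) ..
  · by_cases h : j = k
    · subst h
      exact (Function.update_self ..).trans (Function.update_self (β := fun k => List (Γ' k)) ..).symm
    · exact (Function.update_of_ne (by simpa using h) ..).trans
        (Function.update_of_ne (β := fun k => List (Γ' k)) h ..).symm

/-- A statement as part of a machine with additional stacks, labels and registers. -/
def liftStmt (Γ' : K' → Type) (Λ' σ' : Type) :
    Stmt Γ Λ σ → Stmt (sumAlphabet Γ Γ') (Λ ⊕ Λ') (σ × σ')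
  | .push k f q => .push (Sum.inl k) (fun v => f v.1) (liftStmt Γ' Λ' σ' q)
  | .peek k f q => .peek (Sum.inl k) (fun v o => (f v.1 o, v.2)) (liftStmt Γ' Λ' σ' q)
  | .pop k f q => .pop (Sum.inl k) (fun v o => (f v.1 o, v.2)) (liftStmt Γ' Λ' σ' q)
  | .load f q => .load (fun v => (f v.1, v.2)) (liftStmt Γ' Λ' σ' q)
  | .branch f q₁ q₂ => .branch (fun v => f v.1) (liftStmt Γ' Λ' σ' q₁) (liftStmt Γ' Λ' σ' q₂)
  | .goto f => .goto fun v => Sum.inl (f v.1)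
  | .halt => .halt

/-- A configuration as a configuration of a machine with additional stacks, labels and
registers. -/
def liftCfg (Λ' : Type) (e : σ') (E : ∀ k, List (Γ' k)) (c : Cfg Γ Λ σ) :
    Cfg (sumAlphabet Γ Γ') (Λ ⊕ Λ') (σ × σ') :=
  ⟨c.l.map Sum.inl, (c.var, e), sumStacks c.stk E⟩

theorem stepAux_liftStmt [DecidableEq K] [DecidableEq K'] (q : Stmt Γ Λ σ) (v : σ) (e : σ')
    (S : ∀ k, List (Γ k)) (E : ∀ k, List (Γ' k)) :
    stepAux (liftStmt Γ' Λ' σ' q) (v, e) (sumStacks S E) =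
      liftCfg Λ' e E (stepAux q v S) := by
  induction q generalizing v S with
  | push k f q ih =>
    exact (congrArg _ (update_sumStacks_inl _ _ _ _)).trans (ih _ _)
  | peek k f q ih => exact ih _ _
  | pop k f q ih =>
    exact (congrArg _ (update_sumStacks_inl _ _ _ _)).trans (ih _ _)
  | load f q ih => exact ih _ _
  | branch f q₁ q₂ ih₁ ih₂ =>
    simp only [liftStmt, stepAux]
    cases f v
    · exact ih₂ _ _
    · exact ih₁ _ _
  | goto f => rfl
  | halt => rfl

theorem step_liftCfg [DecidableEq K] [DecidableEq K'] {m : Λ → Stmt Γ Λ σ}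
    {m' : Λ ⊕ Λ' → Stmt (sumAlphabet Γ Γ') (Λ ⊕ Λ') (σ × σ')}
    (hm : ∀ l, m' (Sum.inl l) = liftStmt Γ' Λ' σ' (m l)) (e : σ') (E : ∀ k, List (Γ' k))
    (c c' : Cfg Γ Λ σ) (h : step m c = some c') :
    step m' (liftCfg Λ' e E c) = some (liftCfg Λ' e E c') := by
  rcases c with ⟨_ | l, v, S⟩
  · cases h
  · cases h
    simp only [liftCfg, Option.map_some, step, hm, stepAux_liftStmt]

/-- The statement that pushes the letters of a list on a stack, the first letter first. -/
def pushList (k : K) : List (Γ k) → Stmt Γ Λ σ → Stmt Γ Λ σ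
  | [], q => q
  | g :: l, q => .push k (fun _ => g) (pushList k l q)

theorem stepAux_pushList [DecidableEq K] (k : K) (l : List (Γ k)) (q : Stmt Γ Λ σ) (v : σ)
    (S : ∀ k, List (Γ k)) :
    stepAux (pushList k l q) v S = stepAux q v (Function.update S k (l.reverse ++ S k)) := by
  induction l generalizing S with
  | nil => simp [pushList]
  | cons g l ih => simp [pushList, ih]

end TM2

/-! ### Preprocessing by a finite-state transducer -/

/-- The output of the finite-state transducer `δ` started in the state `q`. -/
def transduce {Q A G : Type} (δ : Q → A → Q × List G) : Q → List A → List G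
  | _, [] => []
  | q, a :: x => (δ q a).2 ++ transduce δ (δ q a).1 x

/-- The alphabets of the two additional stacks of `transducerTM`: the input stack (`true`), and
the stack that receives the output of the transducer (`false`). -/
abbrev transducerStack (A G : Type) : Bool → Type
  | true => A
  | false => G

/-- The additional labels of `transducerTM`: read the next letter in a given state; process a given
letter in a given state; move the transduced word to the input stack of the original machine. -/
abbrev TransducerLabel (Q A G : Type) : Type := Q ⊕ (Q × A) ⊕ Option G

/-- The program of `transducerTM`. -/
def transducerProgram (N : FinTM2) {Q A : Type} (δ : Q → A → Q × List (N.Γ N.k₀)) :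
    N.Λ ⊕ TransducerLabel Q A (N.Γ N.k₀) →
      TM2.Stmt (TM2.sumAlphabet N.Γ (transducerStack A (N.Γ N.k₀)))
        (N.Λ ⊕ TransducerLabel Q A (N.Γ N.k₀)) (N.σ × Option A × Option (N.Γ N.k₀))
  | Sum.inl l => TM2.liftStmt _ _ _ (N.m l)
  | Sum.inr (Sum.inl q) =>
      .pop (Sum.inr true) (fun v o => (v.1, o, v.2.2)) <| .goto fun v =>
        Sum.inr (v.2.1.elim (Sum.inr (Sum.inr none)) fun a => Sum.inr (Sum.inl (q, a)))
  | Sum.inr (Sum.inr (Sum.inl (q, a))) =>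
      TM2.pushList (Sum.inr false) (δ q a).2 <| .goto fun _ => Sum.inr (Sum.inl (δ q a).1)
  | Sum.inr (Sum.inr (Sum.inr none)) =>
      .pop (Sum.inr false) (fun v o => (v.1, v.2.1, o)) <| .goto fun v =>
        v.2.2.elim (Sum.inl N.main) fun g => Sum.inr (Sum.inr (Sum.inr (some g)))
  | Sum.inr (Sum.inr (Sum.inr (some g))) =>
      .push (Sum.inl N.k₀) (fun _ => g) <| .goto fun _ => Sum.inr (Sum.inr (Sum.inr none))

/-- The machine that runs the finite-state transducer `δ` on its input, and `N` on the result. -/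
def transducerTM (N : FinTM2) {Q A : Type} [Fintype Q] [Fintype A]
    (δ : Q → A → Q × List (N.Γ N.k₀)) (q₀ : Q) : FinTM2 :=
  letI := N.kFin
  letI := N.ΛFin
  letI := N.σFin
  letI := N.Γk₀Fin
  { K := N.K ⊕ Bool
    k₀ := Sum.inr true
    k₁ := Sum.inl N.k₁
    Γ := TM2.sumAlphabet N.Γ (transducerStack A (N.Γ N.k₀))
    Λ := N.Λ ⊕ TransducerLabel Q A (N.Γ N.k₀)
    main := Sum.inr (Sum.inl q₀)
    σ := N.σ × Option A × Option (N.Γ N.k₀)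
    initialState := (N.initialState, none, none)
    Γk₀Fin := inferInstanceAs (Fintype A)
    m := transducerProgram N δ }

section

variable (N : FinTM2) {Q A : Type} (δ : Q → A → Q × List (N.Γ N.k₀))

/-- The contents of the additional stacks of `transducerTM`. -/
def transducerStacks {A G : Type} (x : List A) (y : List G) : ∀ b, List (transducerStack A G b)
  | true => x
  | false => y

theorem update_transducerStacks_true {A G : Type} (x x' : List A) (y : List G) :
    Function.update (transducerStacks x y) true x' = transducerStacks x' y := by
  funext b; cases b <;> rfl

theorem update_transducerStacks_false {A G : Type} (x : List A) (y y' : List G) :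
    Function.update (transducerStacks x y) false y' = transducerStacks x y' := by
  funext b; cases b <;> rfl

/-- Two steps per letter (pop, then push the output), and one to notice the empty stack. The output
accumulates in reverse; `o` and `y` are general for the induction. -/
theorem transducer_read (v : N.σ) (S : ∀ k, List (N.Γ k)) (g : Option (N.Γ N.k₀)) (x : List A) :
    ∀ (q : Q) (o : Option A) (y : List (N.Γ N.k₀)),
      StepsTo (TM2.step (transducerProgram N δ)) (2 * x.length + 1)
        ⟨some (Sum.inr (Sum.inl q)), (v, o, g), TM2.sumStacks S (transducerStacks x y)⟩
        ⟨some (Sum.inr (Sum.inr (Sum.inr none))), (v, none, g),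
          TM2.sumStacks S (transducerStacks [] ((transduce δ q x).reverse ++ y))⟩ := by
  induction x with
  | nil =>
    intro q o y
    refine StepsTo.single ?_
    simp only [TM2.step, transducerProgram, TM2.stepAux, TM2.update_sumStacks_inr]
    rw [update_transducerStacks_true]
    rfl
  | cons a x ih =>
    intro q o y
    have h := ih (δ q a).1 (some a) ((δ q a).2.reverse ++ y)
    rw [List.length_cons, show 2 * (x.length + 1) + 1 = 2 * x.length + 1 + 1 + 1 by ring]
    refine StepsTo.head (b := ⟨some (Sum.inr (Sum.inr (Sum.inl (q, a)))), (v, some a, g),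
      TM2.sumStacks S (transducerStacks x y)⟩) ?_ (StepsTo.head
      (b := ⟨some (Sum.inr (Sum.inl (δ q a).1)), (v, some a, g),
        TM2.sumStacks S (transducerStacks x ((δ q a).2.reverse ++ y))⟩) ?_ ?_)
    · simp only [TM2.step, transducerProgram, TM2.stepAux, TM2.update_sumStacks_inr]
      rw [update_transducerStacks_true]
      rfl
    · simp only [TM2.step, transducerProgram, TM2.stepAux_pushList, TM2.stepAux,
        TM2.update_sumStacks_inr]
      rw [update_transducerStacks_false]
      rfl
    · simpa [transduce] using h

/-- Moving between stacks reverses again, which restores the order of the transduced word. -/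
theorem transducer_move (v : N.σ) (S : ∀ k, List (N.Γ k)) (o : Option A)
    (y : List (N.Γ N.k₀)) :
    ∀ (g : Option (N.Γ N.k₀)) (z : List (N.Γ N.k₀)),
      StepsTo (TM2.step (transducerProgram N δ)) (2 * y.length + 1)
        ⟨some (Sum.inr (Sum.inr (Sum.inr none))), (v, o, g),
          TM2.sumStacks (Function.update S N.k₀ z) (transducerStacks [] y)⟩
        ⟨some (Sum.inl N.main), (v, o, none),
          TM2.sumStacks (Function.update S N.k₀ (y.reverse ++ z)) (transducerStacks [] [])⟩ := by
  induction y with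
  | nil =>
    intro g z
    refine StepsTo.single ?_
    simp only [TM2.step, transducerProgram, TM2.stepAux, TM2.update_sumStacks_inr]
    rw [update_transducerStacks_false]
    rfl
  | cons a y ih =>
    intro g z
    have h := ih (some a) (a :: z)
    rw [List.length_cons, show 2 * (y.length + 1) + 1 = 2 * y.length + 1 + 1 + 1 by ring]
    refine StepsTo.head (b := ⟨some (Sum.inr (Sum.inr (Sum.inr (some a)))), (v, o, some a),
      TM2.sumStacks (Function.update S N.k₀ z) (transducerStacks [] y)⟩) ?_ (StepsTo.head
      (b := ⟨some (Sum.inr (Sum.inr (Sum.inr none))), (v, o, some a),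
        TM2.sumStacks (Function.update S N.k₀ (a :: z)) (transducerStacks [] y)⟩) ?_ ?_)
    · simp only [TM2.step, transducerProgram, TM2.stepAux, TM2.update_sumStacks_inr]
      rw [update_transducerStacks_false]
      rfl
    · simp only [TM2.step, transducerProgram, TM2.stepAux, TM2.update_sumStacks_inl]
      simp [TM2.sumStacks]
    · simpa using h

end

end Turing

/-! ### Timed runs: determinism and preprocessing -/

namespace PolyDim

open Turing

theorem runsIn_iff {Γ₀ Γ₁ : Type} {M : TM2ComputableAux Γ₀ Γ₁} {x : List Γ₀} {y : List Γ₁}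
    {t : ℕ} : RunsIn M x y t ↔ ∃ n ≤ t, StepsTo (TM2.step M.tm.m)
      n (initList M.tm (x.map M.inputAlphabet.invFun))
        (haltList M.tm (y.map M.outputAlphabet.invFun)) :=
  ⟨fun ⟨h⟩ => ⟨h.steps, h.steps_le_m, h.evals_in_steps⟩, fun ⟨n, hn, h⟩ => ⟨⟨⟨n, h⟩, hn⟩⟩⟩

theorem RunsIn.mono {Γ₀ Γ₁ : Type} {M : TM2ComputableAux Γ₀ Γ₁} {x : List Γ₀} {y : List Γ₁}
    {t t' : ℕ} (h : RunsIn M x y t) (ht : t ≤ t') : RunsIn M x y t' :=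
  let ⟨h⟩ := h
  ⟨⟨h.toEvalsTo, h.steps_le_m.trans ht⟩⟩

theorem RunsIn.unique {Γ₀ Γ₁ : Type} {M : TM2ComputableAux Γ₀ Γ₁} {x : List Γ₀}
    {y y' : List Γ₁} {t t' : ℕ} (h : RunsIn M x y t) (h' : RunsIn M x y' t') : y = y' := by
  obtain ⟨n, -, h⟩ := runsIn_iff.1 h
  obtain ⟨n', -, h'⟩ := runsIn_iff.1 h'
  exact List.map_injective_iff.2 M.outputAlphabet.symm.injective
    (haltList_injective _ (stepsTo_halt_unique h rfl h' rfl))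

/-- The machine that runs the finite-state transducer `δ` on its input, and `M` on the result. -/
def transducerAux {Γ₀ Γ₁ Q A : Type} [Fintype Q] [Fintype A] (M : TM2ComputableAux Γ₀ Γ₁)
    (δ : Q → A → Q × List Γ₀) (q₀ : Q) : TM2ComputableAux A Γ₁ where
  tm := transducerTM M.tm (fun q a => ((δ q a).1, (δ q a).2.map M.inputAlphabet.symm)) q₀
  inputAlphabet := Equiv.refl A
  outputAlphabet := M.outputAlphabet

theorem transduce_map {Q A G H : Type} (δ : Q → A → Q × List G) (f : G → H) (x : List A) :
    ∀ q, transduce (fun q a => ((δ q a).1, (δ q a).2.map f)) q x = (transduce δ q x).map f := by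
  induction x with
  | nil => intro q; rfl
  | cons a x ih => intro q; simp [transduce, ih]

/-- Read, move, then run the lifted `M`. A valid halting configuration needs the initial registers
and all non-output stacks empty; this holds because each auxiliary stack is popped until it returns
`none`. -/
theorem RunsIn.transducerAux {Γ₀ Γ₁ Q A : Type} [Fintype Q] [Fintype A]
    {M : TM2ComputableAux Γ₀ Γ₁} (δ : Q → A → Q × List Γ₀) (q₀ : Q) {x : List A} {y : List Γ₁}
    {t : ℕ} (h : RunsIn M (transduce δ q₀ x) y t) :
    RunsIn (transducerAux M δ q₀) x y (2 * x.length + 2 * (transduce δ q₀ x).length + t + 2) := by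
  obtain ⟨n, hn, h⟩ := runsIn_iff.1 h
  refine runsIn_iff.2 ⟨(2 * x.length + 1) + ((2 * (transduce δ q₀ x).length + 1) + n),
    by omega, ?_⟩
  set N := M.tm
  set δ' : Q → A → Q × List (N.Γ N.k₀) :=
    fun q a => ((δ q a).1, (δ q a).2.map M.inputAlphabet.symm) with hδ'
  have h₁ := transducer_read N δ' N.initialState (fun _ => []) none x q₀ none []
  have h₂ := transducer_move N δ' N.initialState (fun _ => []) none
    (transduce δ' q₀ x).reverse none []
  have h₃ := StepsTo.map (TM2.liftCfg (TransducerLabel Q A (N.Γ N.k₀))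
      ((none, none) : Option A × Option (N.Γ N.k₀)) (transducerStacks [] []))
    (TM2.step_liftCfg (m' := transducerProgram N δ') (fun l => rfl) _ _) h
  have hx : transduce δ' q₀ x = (transduce δ q₀ x).map M.inputAlphabet.symm :=
    transduce_map δ M.inputAlphabet.symm x q₀
  rw [initList_eq] at h₃
  simp only [hx, List.length_reverse, List.length_map, List.reverse_reverse,
    List.append_nil, Function.update_eq_self] at h₁ h₂ h₃
  have h := h₁.trans (h₂.trans h₃)
  refine (congrArg₂ (StepsTo _ _) ?_ ?_).mpr h
  · rw [initList_eq]
    refine congrArg (TM2.Cfg.mk _ _) ?_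
    funext k
    rcases k with k | b
    · rfl
    · cases b
      · rfl
      · exact List.map_id _
  · rw [haltList_eq, haltList_eq]
    refine congrArg (TM2.Cfg.mk _ _) ?_
    rw [← TM2.update_sumStacks_inl]
    refine congrArg (fun S => Function.update S _ _) ?_
    funext k
    rcases k with k | b
    · rfl
    · cases b <;> rfl

end PolyDim

namespace PolyDim

open Turing

/-! ### Exactly computable gales -/

/-- The first `false` in a marker position shows where the first word ends. -/
theorem flatMap_marked_append_inj {a a' b b' : List Bool}
    (h : (a.flatMap fun x => [true, x]) ++ false :: b =
      (a'.flatMap fun x => [true, x]) ++ false :: b') : a = a' ∧ b = b' := by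
  induction a generalizing a' with
  | nil => cases a' <;> simp_all
  | cons x a ih =>
    cases a' with
    | nil => simp at h
    | cons x' a' =>
      simp only [List.flatMap_cons, List.cons_append, List.nil_append, List.cons.injEq,
        true_and] at h
      obtain ⟨rfl, rfl⟩ := ih h.2
      exact ⟨by rw [h.1], rfl⟩

theorem encodeRat_injective : Function.Injective encodeRat := by
  intro v v' h
  obtain ⟨h₁, h₂⟩ := flatMap_marked_append_inj h
  have hinj : Function.Injective Computability.encodeNat :=
    Function.LeftInverse.injective Computability.decode_encodeNat
  exact NNRat.ext_num_den (hinj h₁) (hinj h₂)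

/-- A function that is exactly computable in polynomial time is determined by the program with
which the universal machine computes it. -/
theorem countable_exactPolyTime {U : TM2ComputableAux Bool Bool} (hU : IsUniversal U) :
    {d | ExactPolyTime d}.Countable := by
  have hprog : ∀ d, ExactPolyTime d →
      ∃ π : List Bool, ∀ w, ∃ t, RunsIn U (π ++ w) (encodeRat (d w)) t := by
    rintro d ⟨D⟩
    obtain ⟨π, P, h⟩ := hU D.toTM2ComputableAux
    exact ⟨π, fun w => ⟨_, h w _ _ ⟨D.outputsFun w⟩⟩⟩
  choose! π hπ using hprog
  refine Set.MapsTo.countable_of_injOn (f := π) (t := Set.univ) (Set.mapsTo_univ _ _) ?_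
    (Set.to_countable _)
  intro d hd d' hd' h
  funext w
  obtain ⟨t, ht⟩ := hπ d hd w
  obtain ⟨t', ht'⟩ := hπ d' hd' w
  rw [← h] at ht'
  exact encodeRat_injective (ht.unique ht')

theorem transduce_untag (w : List Bool) :
    transduce (fun (_ : Unit) (a : Bool ⊕ Bool) => ((), [a.elim id id])) () (withCoins w []) =
      w := by
  induction w with
  | nil => rfl
  | cons b w ih => exact congrArg (b :: ·) ih

theorem ExactPolyTime.isPolyTimeApproximable {d : List Bool → ℚ≥0} (hd : ExactPolyTime d)
    (ν : Measure (ℕ → Bool)) : IsPolyTimeApproximable ν d := by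
  obtain ⟨D⟩ := hd
  set M : ProbMachine := transducerAux D.toTM2ComputableAux
    (fun (_ : Unit) (a : Bool ⊕ Bool) => ((), [a.elim id id])) ()
  -- Untagging preserves length, so reading and moving cost `2n` each, plus two end-of-stack steps.
  set T : Polynomial ℕ := 4 * Polynomial.X + D.time + 2
  have hrun : ∀ w, RunsIn M (withCoins w []) (encodeRat (d w)) (T.eval w.length) := by
    intro w
    have h : RunsIn D.toTM2ComputableAux (transduce (fun (_ : Unit) (a : Bool ⊕ Bool) =>
        ((), [a.elim id id])) () (withCoins w [])) (encodeRat (d w)) (D.time.eval w.length) :=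
      (transduce_untag w).symm ▸ ⟨D.outputsFun w⟩
    refine h.transducerAux.mono ?_
    simp only [transduce_untag]
    simp only [withCoins, T, Polynomial.eval_add, Polynomial.eval_mul, Polynomial.eval_X,
      Polynomial.eval_ofNat, List.map_nil, List.append_nil, List.length_map]
    omega
  have happ : ∀ w r : List Bool, r.length = 0 →
      ApproximatesAt M d (1 / 2) w r (T.eval w.length) := by
    intro w r hr
    obtain rfl := List.eq_nil_of_length_eq_zero hr
    have : (0 : ℝ) ≤ d w := NNRat.cast_nonneg _
    exact ⟨d w, hrun w, by linarith, le_rfl⟩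
  -- No coins; the output is exact, so any `c` in `(0,1)` serves for every `k`.
  refine ⟨T, fun k => ⟨M, 0, 1 / 2, by norm_num, by norm_num, ?_, ?_, ?_⟩⟩
  · intro w r hr
    obtain ⟨v, hv, -⟩ := happ w r (by simpa using hr)
    exact ⟨_, hv⟩
  · intro w r hr h
    exact absurd (happ w r (by simpa using hr)) h
  · intro n
    refine (Finset.sum_eq_zero fun w _ => ?_).trans_le zero_le
    have : IsEmpty {r : Fin ((0 : Polynomial ℕ).eval n) → Bool //
        ¬ ApproximatesAt M d (1 / 2) (List.ofFn w) (List.ofFn r) (T.eval n)} := by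
      refine ⟨fun ⟨r, hr⟩ => hr ?_⟩
      have := happ (List.ofFn w) (List.ofFn r) (by simp)
      rwa [List.length_ofFn] at this
    rw [coinProb, Nat.card_eq_zero.2 (Or.inl this)]
    simp

theorem IsGale.isSupergale {s s' : ℝ} {d : List Bool → ℚ≥0} (hd : IsGale s d) (h : s ≤ s') :
    IsSupergale s' d := by
  refine ⟨hd.1, fun w => ?_⟩
  rw [hd.2 w]
  gcongr
  norm_num

theorem ae_half_le_cdimP {U : TM2ComputableAux Bool Bool} (hU : IsUniversal U)
    (ν : Measure (ℕ → Bool)) {s : ℝ} (hs : s < 1 / 2)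
    (hgale : ∀ s' : ℝ, s < s' → s' < 1 / 2 → ∀ d : List Bool → ℚ≥0,
      IsSupergale s' d → IsPolyTimeApproximable ν d → ν (successSet d) = 0) :
    ∀ᵐ X ∂ν, 1 / 2 ≤ cdimP X := by
  -- Only `d` ranges over a countable set; the uncountably many exponents are hidden in an
  -- existential that does not involve `X`.
  have h : ∀ᵐ X ∂ν, ∀ d ∈ {d | ExactPolyTime d}, ∀ _ : ∃ u : ℝ, u < 1 / 2 ∧ IsGale u d,
      X ∉ successSet d := by
    refine (ae_ball_iff (countable_exactPolyTime hU)).2 fun d hd => ?_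
    by_cases hu : ∃ u : ℝ, u < 1 / 2 ∧ IsGale u d
    · obtain ⟨u, hu, hg⟩ := hu
      -- The exponent `u` may be at most `s`, so it is raised into `(s, 1/2)`.
      obtain ⟨s', hs', hs'₂⟩ := exists_between (max_lt hs hu)
      have := hgale s' ((le_max_left _ _).trans_lt hs') hs'₂ d
        (hg.isSupergale ((le_max_right _ _).trans hs'.le)) (hd.isPolyTimeApproximable ν)
      filter_upwards [measure_eq_zero_iff_ae_notMem.1 this] with X hX _ using hX
    · exact ae_of_all _ fun X h => absurd h hu
  filter_upwards [h] with X hX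
  refine le_iInf₂ fun u ⟨d, hg, hd, hmem⟩ => ?_
  by_contra! hu
  refine hX d hd ⟨u, ?_, hg⟩ hmem
  have : u < 1 / 2 := by
    rw [← ENNReal.coe_lt_coe]
    simpa using hu
  exact_mod_cast this

/-! ### Programs from samplers -/

/-- The transducer that reads `1ᵃ 0 1ᵇ 0 r` and prints the input `1ⁿ` with coins `r`, where
`n = m * a + b`. -/
def blockTransducer (m : ℕ) : Fin 3 → Bool → Fin 3 × List (Bool ⊕ Bool)
  | 0, true => (0, List.replicate m (Sum.inl true))
  | 0, false => (1, [])
  | 1, true => (1, [Sum.inl true])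
  | 1, false => (2, [])
  | 2, b => (2, [Sum.inr b])

/-- The code from which `blockTransducer m` produces the input `1ⁿ` with coins `r`. -/
def blockCode (m n : ℕ) (r : List Bool) : List Bool :=
  List.replicate (n / m) true ++ false :: (List.replicate (n % m) true ++ false :: r)

theorem length_blockCode (m n : ℕ) (r : List Bool) :
    (blockCode m n r).length = n / m + n % m + r.length + 2 := by
  simp [blockCode]; ring

theorem length_withCoins (w r : List Bool) : (withCoins w r).length = w.length + r.length := by
  simp [withCoins]

theorem transduce_blockCode (m n : ℕ) (r : List Bool) :
    transduce (blockTransducer m) 0 (blockCode m n r) = withCoins (List.replicate n true) r := by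
  have h₂ : ∀ r, transduce (blockTransducer m) 2 r = r.map Sum.inr := by
    intro r
    induction r with
    | nil => rfl
    | cons b r ih => exact congrArg (Sum.inr b :: ·) ih
  have h₁ : ∀ b, transduce (blockTransducer m) 1 (List.replicate b true ++ false :: r) =
      List.replicate b (Sum.inl true) ++ r.map Sum.inr := by
    intro b
    induction b with
    | zero => exact h₂ r
    | succ b ih => exact congrArg (Sum.inl true :: ·) ih
  have h₀ : ∀ a b, transduce (blockTransducer m) 0
      (List.replicate a true ++ false :: (List.replicate b true ++ false :: r)) =
      List.replicate (m * a + b) (Sum.inl true) ++ r.map Sum.inr := by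
    intro a b
    induction a with
    | zero => rw [mul_zero, zero_add]; exact h₁ b
    | succ a ih =>
      refine (congrArg (List.replicate m (Sum.inl true) ++ ·) ih).trans ?_
      rw [← List.append_assoc, ← List.replicate_add]
      congr 2
      ring
  rw [blockCode, h₀, Nat.div_add_mod, withCoins, List.map_replicate]

theorem polynomial_eval_mono (P : Polynomial ℕ) : Monotone fun n => P.eval n := by
  intro a b h
  simp only [Polynomial.eval_eq_sum_range]
  gcongr

/-- The time bounds in `KstrPoly` are pure powers; for `n ≥ 2` a coefficient `a ≤ 2 ^ a ≤ n ^ a` is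
absorbed into the exponent. -/
theorem exists_eval_le_pow (P : Polynomial ℕ) : ∃ c : ℕ, ∀ n, 2 ≤ n → P.eval n ≤ n ^ c := by
  induction P using Polynomial.induction_on' with
  | add p q hp hq =>
    obtain ⟨a, ha⟩ := hp
    obtain ⟨b, hb⟩ := hq
    refine ⟨max a b + 1, fun n hn => ?_⟩
    have h₁ := (ha n hn).trans (Nat.pow_le_pow_right (by omega) (le_max_left a b))
    have h₂ := (hb n hn).trans (Nat.pow_le_pow_right (by omega) (le_max_right a b))
    rw [Polynomial.eval_add, pow_succ]
    nlinarith
  | monomial k a =>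
    refine ⟨a + k, fun n hn => ?_⟩
    rw [Polynomial.eval_monomial, pow_add]
    gcongr
    exact a.lt_two_pow_self.le.trans (Nat.pow_le_pow_left hn a)

/-- Prefixes of a sequence with seeds of length at most `s * n` have short programs. -/
theorem KstrPoly_le_of_sampled {U : TM2ComputableAux Bool Bool} (hU : IsUniversal U)
    (M : ProbMachine) {q : ℕ → ℕ} {T : Polynomial ℕ} (hqT : ∀ n, q n ≤ T.eval n) {s : ℝ}
    (hq : ∀ n, (q n : ℝ) ≤ s * n) {X : ℕ → Bool}
    (hX : ∀ n, ∃ r : List Bool, r.length = q n ∧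
      RunsIn M (withCoins (List.replicate n true) r) (pre X n) (T.eval n)) :
    KstrPoly U X ≤ ENNReal.ofReal s := by
  -- With blocks of size `m + 1`, one `1 / (m + 1)` pays for the quotient and the other for `π`, the
  -- remainder and the two separators.
  have key : ∀ m : ℕ, KstrPoly U X ≤ ENNReal.ofReal (s + 2 / ((m : ℝ) + 1)) := by
    intro m
    obtain ⟨π, P, hP⟩ := hU (transducerAux M (blockTransducer (m + 1)) 0)
    obtain ⟨c, hc⟩ := exists_eval_le_pow
      -- The code has length at most `n + T + 2`; add the transducer's overhead and the run time
      -- `T`.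
      (P.comp (5 * Polynomial.X + 6 * T + 8))
    refine (iInf_le _ c).trans (limsup_le_of_le (by isBoundedDefault) ?_)
    -- The `2` is for `hc`, the product for `h₃`.
    filter_upwards [eventually_ge_atTop (2 + (m + 1) * (π.length + m + 2))] with n hn
    obtain ⟨r, hr, hrun⟩ := hX n
    rw [← transduce_blockCode (m + 1)] at hrun
    have hdiv := Nat.div_add_mod n (m + 1)
    have hmod : n % (m + 1) < m + 1 := Nat.mod_lt _ (by omega)
    have hle : n / (m + 1) + n % (m + 1) ≤ n := by nlinarith [Nat.zero_le (m * (n / (m + 1)))]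
    have hT := hqT n
    have hrunU : RunsIn U (π ++ blockCode (m + 1) n r) (pre X n) (n ^ c) := by
      refine (hP _ _ _ hrun.transducerAux).mono (le_trans ?_ (hc n (by omega)))
      rw [Polynomial.eval_comp]
      refine polynomial_eval_mono P ?_
      simp only [transduce_blockCode, length_blockCode, length_withCoins, List.length_replicate,
        hr, Polynomial.eval_add, Polynomial.eval_mul, Polynomial.eval_X, Polynomial.eval_ofNat]
      omega
    have hK : timeBoundedK U (fun m => m ^ c) (pre X n) ≤
        ((π ++ blockCode (m + 1) n r).length : ℕ∞) :=
      iInf₂_le _ (by simpa [pre] using hrunU)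
    have hn₀ : (0 : ℝ) < n := by exact_mod_cast (show 0 < n by omega)
    have hlen : ((π ++ blockCode (m + 1) n r).length : ℝ) ≤ (s + 2 / ((m : ℝ) + 1)) * n := by
      rw [List.length_append, length_blockCode, hr]
      have h₁ : ((n / (m + 1) : ℕ) : ℝ) ≤ n / ((m : ℝ) + 1) := by
        simpa using Nat.cast_div_le (α := ℝ) (m := n) (n := m + 1)
      have h₂ : ((n % (m + 1) : ℕ) : ℝ) ≤ m := by exact_mod_cast Nat.lt_succ_iff.1 hmod
      have h₃ : ((π.length + m + 2 : ℕ) : ℝ) ≤ n / ((m : ℝ) + 1) := by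
        rw [le_div_iff₀ (by positivity)]
        exact_mod_cast (show (π.length + m + 2) * (m + 1) ≤ n by
          rw [mul_comm]; omega)
      have h₄ : (s + 2 / ((m : ℝ) + 1)) * n = s * n + 2 * (n / ((m : ℝ) + 1)) := by ring
      have h₅ := hq n
      push_cast at h₃ ⊢
      linarith
    calc ((timeBoundedK U (fun m => m ^ c) (pre X n) : ℕ∞) : ℝ≥0∞) / (n : ℝ≥0∞)
        ≤ (((π ++ blockCode (m + 1) n r).length : ℕ) : ℝ≥0∞) / (n : ℝ≥0∞) := by
          gcongr
          exact_mod_cast ENat.toENNReal_le.2 hK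
      _ = ENNReal.ofReal ((π ++ blockCode (m + 1) n r).length / n) := by
          rw [ENNReal.ofReal_div_of_pos hn₀, ENNReal.ofReal_natCast, ENNReal.ofReal_natCast]
      _ ≤ _ := ENNReal.ofReal_le_ofReal ((div_le_iff₀ hn₀).2 hlen)
  refine ge_of_tendsto' (x := atTop) ?_ key
  refine (ENNReal.continuous_ofReal.tendsto s).comp ?_
  have h : Tendsto (fun m : ℕ => 2 * (1 / ((m : ℝ) + 1))) atTop (nhds (2 * 0)) :=
    tendsto_one_div_add_atTop_nhds_zero_nat.const_mul 2
  simpa [div_eq_mul_inv] using h.const_add s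

/-- There are only countably many null cylinders. -/
theorem ae_forall_cylinder_ne_zero (ν : Measure (ℕ → Bool)) :
    ∀ᵐ X ∂ν, ∀ n, ν (cylinder (pre X n)) ≠ 0 := by
  have h : ∀ᵐ X ∂ν, ∀ w : List Bool, ν (cylinder w) = 0 → X ∉ cylinder w := by
    refine ae_all_iff.2 fun w => ?_
    by_cases hw : ν (cylinder w) = 0
    · filter_upwards [measure_eq_zero_iff_ae_notMem.1 hw] with X hX _ using hX
    · exact ae_of_all _ fun X h => absurd h hw
  filter_upwards [h] with X hX n hn
  exact hX _ hn (by simp [cylinder, pre])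

theorem exists_of_coinProb_ne_zero {m : ℕ} {P : List Bool → Prop} (h : coinProb m P ≠ 0) :
    ∃ r : List Bool, r.length = m ∧ P r := by
  by_contra! hP
  have : IsEmpty {r : Fin m → Bool // P (List.ofFn r)} :=
    ⟨fun ⟨r, hr⟩ => hP _ (by simp) hr⟩
  exact h (by rw [coinProb, Nat.card_eq_zero.2 (Or.inl this)]; simp)

theorem ae_KstrPoly_le {U : TM2ComputableAux Bool Bool} (hU : IsUniversal U)
    (ν : Measure (ℕ → Bool)) {M : ProbMachine} {q : ℕ → ℕ} (hM : IsPolyTimeSampler ν M q) {s : ℝ}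
    (hq : ∀ n : ℕ, (q n : ℝ) ≤ s * n) : ∀ᵐ X ∂ν, KstrPoly U X ≤ ENNReal.ofReal s := by
  obtain ⟨T, hqT, -, hT⟩ := hM
  filter_upwards [ae_forall_cylinder_ne_zero ν] with X hX
  refine KstrPoly_le_of_sampled hU M hqT hq fun n => ?_
  refine exists_of_coinProb_ne_zero ?_
  rw [hT n (pre X n) (by simp [pre])]
  exact hX n

end PolyDim

theorem mainTheorem7
    (U : Turing.TM2ComputableAux Bool Bool) (hU : PolyDim.IsUniversal U)
    (ν : Measure (ℕ → Bool)) [IsProbabilityMeasure ν] (s : ℝ) (hs : s < 1 / 2)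
    (hsample : ∃ (M : PolyDim.ProbMachine) (q : ℕ → ℕ),
      PolyDim.IsPolyTimeSampler ν M q ∧ ∀ n : ℕ, (q n : ℝ) ≤ s * (n : ℝ))
    (hgale : ∀ s' : ℝ, s < s' → s' < 1 / 2 → ∀ d : List Bool → ℚ≥0,
      PolyDim.IsSupergale s' d → PolyDim.IsPolyTimeApproximable ν d →
        ν (PolyDim.successSet d) = 0) :
    ∀ᵐ X ∂ν, PolyDim.KstrPoly U X ≤ ENNReal.ofReal s ∧ 1 / 2 ≤ PolyDim.cdimP X := by
  obtain ⟨M, q, hM, hq⟩ := hsample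
  exact (PolyDim.ae_KstrPoly_le hU ν hM hq).and (PolyDim.ae_half_le_cdimP hU ν hs hgale)
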